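/- Let $M\ge 2$ be an integer and let $\mathcal X=\{e^{i(\theta+2\pi k/M)}:k=0,\dots,M-1\}\subset\mathbb C$ be the unit-energy $M$-PSK constellation with an arbitrary phase offset $\theta\in\mathbb R$. Consider the complex additive Gaussian noise channel $Y=\sqrt{\mathrm{SNR}}\,X+Z$, where $X$ is uniformly distributed on $\mathcal X$ and $Z$, independent of $X$, is circularly symmetric complex Gaussian of unit variance (density $\pi^{-1}e^{-|z|^2}$ on $\mathbb C$). Let $$C(\mathrm{SNR})=-\mathbb E\left[\log\left(\sum_{x'\in\mathcal X}\frac1M\,e^{-|\sqrt{\mathrm{SNR}}\,(X-x')+Z|^2+|Z|^2}\right)\right],\qquad \mathrm{SNR}\ge 0,$$ be the uniform constrained (coded modulation) capacity of $\mathcal X$ in nats per channel use; the expectation is over $X$ and $Z$ and is of an integrable function. Then there are real coefficients $c_1,c_2$ such that $$C(\mathrm{SNR})=c_1\,\mathrm{SNR}+c_2\,\mathrm{SNR}^2+o(\mathrm{SNR}^2)\qquad(\mathrm{SNR}\to 0^+),$$ the second-order coefficient $c_2$ is uniquely determined, and $c_2=-1$ if $M=2$ and $c_2=-\tfrac12$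 if $M>2$. -/

import Mathlib

open MeasureTheory Filter Topology Asymptotics

noncomputable section

/-- Law of the circularly symmetric complex Gaussian noise of unit variance: density
`π⁻¹ exp (-|z|²)` with respect to Lebesgue measure on `ℂ`. -/
def complexGaussian : Measure ℂ :=
  volume.withDensity fun z => ENNReal.ofReal (Real.pi⁻¹ * Real.exp (-‖z‖ ^ 2))

/-- The logarithm inside the expectation that defines the constrained capacity of the channel
`Y = √snr X + Z`, for the transmitted symbol `x` and the noise value `z`:
`log ∑ x', P x' exp (-|√snr (x - x') + z|² + |z|²)`. -/
def logLikelihoodSum (X : Finset ℂ) (P : ℂ → ℝ) (snr : ℝ) (x z : ℂ) : ℝ :=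
  Real.log (∑ x' ∈ X, P x' *
    Real.exp (-‖((Real.sqrt snr : ℝ) : ℂ) * (x - x') + z‖ ^ 2 + ‖z‖ ^ 2))

/-- The constrained (coded modulation) capacity, in nats per channel use, of the constellation `X`
used with symbol probabilities `P`; the expectation is over the symbol and the noise. -/
def constrainedCapacity (X : Finset ℂ) (P : ℂ → ℝ) (snr : ℝ) : ℝ :=
  -∑ x ∈ X, P x * ∫ z, logLikelihoodSum X P snr x z ∂complexGaussian

/-- Equal symbol probabilities on `X`. -/
def uniformProb (X : Finset ℂ) : ℂ → ℝ := fun _ => (X.card : ℝ)⁻¹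

/-- The uniform capacity of `X`: the constrained capacity with equiprobable symbols. -/
def uniformCapacity (X : Finset ℂ) (snr : ℝ) : ℝ :=
  constrainedCapacity X (uniformProb X) snr

/-- The `M`-PSK constellation of unit energy with phase offset `θ`: the points
`exp (i (θ + 2πk/M))`, `k = 0, …, M - 1`. -/
def psk (M : ℕ) (θ : ℝ) : Finset ℂ :=
  (Finset.range M).image fun k : ℕ =>
    Complex.exp (((θ + 2 * Real.pi * (k : ℝ) / (M : ℝ) : ℝ) : ℂ) * Complex.I)

/-- `c₁` and `c₂` are the first two coefficients of `C` at zero signal-to-noise ratio: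
`C snr = c₁ snr + c₂ snr² + o(snr²)` as `snr → 0⁺`. -/
def HasLowSNRExpansion (C : ℝ → ℝ) (c₁ c₂ : ℝ) : Prop :=
  (fun snr : ℝ => C snr - (c₁ * snr + c₂ * snr ^ 2)) =o[𝓝[>] 0] fun snr : ℝ => snr ^ 2

/-- `c₂` is the second-order coefficient of `C` at zero signal-to-noise ratio. -/
def IsSecondOrderCoefficient (C : ℝ → ℝ) (c₂ : ℝ) : Prop :=
  ∃ c₁ : ℝ, HasLowSNRExpansion C c₁ c₂

end

/-! ### Moments of the complex Gaussian and of its real projections. -/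

section Gaussian

/-! Put `s = √snr`. Since all points have unit norm, the log-likelihood sum at `x` equals `-2s² - 2s
Re(z x̄)` plus the log of the mean over `y` of `exp(2s(s q + g))`, with `q = Re(x ȳ)` and `g = Re(z
ȳ)` (`logLikelihoodSum_uniformProb`). The points sum to zero, so the exponents are centred and the
log-mean-exp has the cumulant expansion `m₂/2 + m₃/6 + m₄/24 - m₂²/8` with a fifth-order error
(`abs_log_mean_exp_sub_le`).

Integrating over the noise kills the terms odd in `g`, and the term `q g²` too because the mean of
`q` is zero. What remains gives `c₁ = 1` and `c₂ = -(2A + 1/2 - 2K)`, where `A` is the mean of `q²`,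
the same for each `x`, and `K` is the Gaussian expectation of the squared mean of `g²`
(`abs_uniformCapacity_sub_le`).

The size of `M` enters only through `∑ y²`. If `M > 2` it vanishes, the mean of `g²` is `‖z‖²/2`,
and `A = K = 1/2`. If `M = 2` the points are antipodal, the mean of `g²` is `Re(z x̄)²`, and `A =
1`, `K = 3/4`. -/

lemma measurable_gaussianDensity : Measurable fun z : ℂ =>
    ENNReal.ofReal (Real.pi⁻¹ * Real.exp (-‖z‖ ^ 2)) := by
  fun_prop

lemma toReal_gaussianDensity (z : ℂ) :
    (ENNReal.ofReal (Real.pi⁻¹ * Real.exp (-‖z‖ ^ 2))).toReal =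
      Real.pi⁻¹ * Real.exp (-‖z‖ ^ 2) :=
  ENNReal.toReal_ofReal (by positivity)

lemma integral_complexGaussian (f : ℂ → ℝ) :
    ∫ z, f z ∂complexGaussian = ∫ z, Real.pi⁻¹ * Real.exp (-‖z‖ ^ 2) * f z := by
  unfold complexGaussian
  rw [integral_withDensity_eq_integral_toReal_smul measurable_gaussianDensity (by simp)]
  simp only [toReal_gaussianDensity, smul_eq_mul]

lemma integral_norm_pow_complexGaussian (n : ℕ) :
    ∫ z, ‖z‖ ^ n ∂complexGaussian = Real.Gamma (((n : ℝ) + 2) / 2) := by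
  have h := Complex.integral_rpow_mul_exp_neg_mul_rpow (p := 2) (q := n) (b := 1)
    (by norm_num) (by linarith [(Nat.cast_nonneg n : (0 : ℝ) ≤ n)]) one_pos
  rw [integral_complexGaussian]
  simp only [mul_assoc]
  rw [integral_const_mul]
  have e : ∀ z : ℂ, Real.exp (-‖z‖ ^ 2) * ‖z‖ ^ n =
      ‖z‖ ^ (n : ℝ) * Real.exp (-1 * ‖z‖ ^ (2 : ℝ)) := by
    intro z
    rw [Real.rpow_natCast, Real.rpow_two, neg_one_mul, mul_comm]
  simp only [e]
  rw [h, Real.one_rpow]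
  field_simp [Real.pi_ne_zero]

lemma integrable_norm_pow_complexGaussian (n : ℕ) :
    Integrable (fun z : ℂ => ‖z‖ ^ n) complexGaussian := by
  -- A non-integrable function has integral `0` by convention, so a nonzero value proves
  -- integrability.
  refine .of_integral_ne_zero ?_
  rw [integral_norm_pow_complexGaussian]
  exact (Real.Gamma_pos_of_pos (by positivity)).ne'

lemma integral_norm_sq_complexGaussian : ∫ z, ‖z‖ ^ 2 ∂complexGaussian = 1 := by
  rw [integral_norm_pow_complexGaussian]
  norm_num

lemma integral_norm_pow_four_complexGaussian : ∫ z, ‖z‖ ^ 4 ∂complexGaussian = 2 := by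
  rw [integral_norm_pow_complexGaussian]
  norm_num [Real.Gamma_ofNat_eq_factorial]

instance : IsProbabilityMeasure complexGaussian := by
  have h : ∫ z, (1 : ℝ) ∂complexGaussian = 1 := by
    simpa using integral_norm_pow_complexGaussian 0
  refine ⟨?_⟩
  rw [integral_const, smul_eq_mul, mul_one, measureReal_def] at h
  rwa [← ENNReal.toReal_eq_one_iff]

/-- Both Lebesgue measure and the density are rotation invariant. -/
lemma integral_complexGaussian_mul_left {u : ℂ} (hu : ‖u‖ = 1) (f : ℂ → ℝ) :
    ∫ z, f (u * z) ∂complexGaussian = ∫ z, f z ∂complexGaussian := by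
  let c : Circle := ⟨u, mem_sphere_zero_iff_norm.2 hu⟩
  have h := (rotation c).measurePreserving.integral_comp
    (rotation c).toHomeomorph.measurableEmbedding
    (fun z => Real.pi⁻¹ * Real.exp (-‖z‖ ^ 2) * f z)
  have hc : ∀ z, rotation c z = u * z := fun z => rfl
  rw [integral_complexGaussian, integral_complexGaussian, ← h]
  simp only [hc, norm_mul, hu, one_mul]

lemma integrable_complexGaussian_of_le {f : ℂ → ℝ} (hf : Continuous f) (C : ℝ) (n : ℕ)
    (h : ∀ z, |f z| ≤ C * (1 + ‖z‖) ^ n) : Integrable f complexGaussian := by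
  have hi : Integrable (fun z : ℂ => C * (1 + ‖z‖) ^ n) complexGaussian := by
    refine Integrable.const_mul ?_ C
    simp only [add_pow, one_pow, one_mul]
    exact integrable_finsetSum _ fun i _ =>
      (integrable_norm_pow_complexGaussian _).mul_const _
  exact hi.mono' hf.aestronglyMeasurable (ae_of_all _ h)

/-- The real inner product `Re (z conj u)` on `ℂ`. -/
noncomputable def reInner (z u : ℂ) : ℝ := (z * starRingEnd ℂ u).re

lemma reInner_eq (z u : ℂ) : reInner z u = z.re * u.re + z.im * u.im := by
  simp [reInner]

lemma continuous_reInner_left (u : ℂ) : Continuous fun z => reInner z u := by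
  unfold reInner; fun_prop

lemma abs_reInner_le {u : ℂ} (hu : ‖u‖ = 1) (z : ℂ) : |reInner z u| ≤ ‖z‖ := by
  refine (Complex.abs_re_le_norm _).trans ?_
  simp [hu]

lemma integrable_reInner_pow {u : ℂ} (hu : ‖u‖ = 1) (n : ℕ) :
    Integrable (fun z => reInner z u ^ n) complexGaussian := by
  refine (integrable_norm_pow_complexGaussian n).mono'
    ((continuous_reInner_left u).pow n).aestronglyMeasurable (ae_of_all _ fun z => ?_)
  rw [Real.norm_eq_abs, abs_pow]
  exact pow_le_pow_left₀ (abs_nonneg _) (abs_reInner_le hu z) n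

lemma integral_reInner_pow_eq {u : ℂ} (hu : ‖u‖ = 1) (n : ℕ) :
    ∫ z, reInner z u ^ n ∂complexGaussian = ∫ z : ℂ, z.re ^ n ∂complexGaussian := by
  rw [← integral_complexGaussian_mul_left (u := starRingEnd ℂ u) (by simpa using hu)
    fun z => z.re ^ n]
  simp only [reInner, mul_comm]

lemma integral_reInner_pow_of_odd (u : ℂ) {n : ℕ} (hn : Odd n) :
    ∫ z, reInner z u ^ n ∂complexGaussian = 0 := by
  have h := integral_complexGaussian_mul_left (u := -1) (by simp) fun z => reInner z u ^ n
  simp only [reInner, neg_mul, one_mul, Complex.neg_re, hn.neg_pow, integral_neg] at h ⊢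
  linarith

lemma integral_reInner (u : ℂ) :
    ∫ z, reInner z u ∂complexGaussian = 0 := by
  simpa using integral_reInner_pow_of_odd u odd_one

lemma integral_reInner_sq {u : ℂ} (hu : ‖u‖ = 1) :
    ∫ z, reInner z u ^ 2 ∂complexGaussian = 1 / 2 := by
  have h1 := integrable_reInner_pow (u := 1) (by simp) 2
  have hI := integrable_reInner_pow (u := Complex.I) (by simp) 2
  have h : ∫ z, (reInner z 1 ^ 2 + reInner z Complex.I ^ 2) ∂complexGaussian = 1 := by
    rw [← integral_norm_sq_complexGaussian]
    congr 1 with z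
    rw [Complex.sq_norm, Complex.normSq_apply]
    simp [reInner_eq]; ring
  rw [integral_add h1 hI, integral_reInner_pow_eq (by simp), integral_reInner_pow_eq (by simp)] at h
  rw [integral_reInner_pow_eq hu]
  linarith

/-- In four directions spaced by 45 degrees the fourth powers of the projections add up to `3/2 *
‖z‖ ^ 4`. By rotation invariance each has the same expectation, a quarter of `3/2 * 2`. -/
lemma integral_reInner_pow_four {u : ℂ} (hu : ‖u‖ = 1) :
    ∫ z, reInner z u ^ 4 ∂complexGaussian = 3 / 4 := by
  set a : ℝ := √2 / 2 with ha
  have ha2 : a ^ 2 = 1 / 2 := by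
    rw [ha, div_pow, Real.sq_sqrt (by norm_num)]; norm_num
  have hv : ‖(⟨a, a⟩ : ℂ)‖ = 1 := by
    rw [← sq_eq_sq₀ (norm_nonneg _) zero_le_one, Complex.sq_norm, Complex.normSq_mk]
    linarith
  have hw : ‖(⟨a, -a⟩ : ℂ)‖ = 1 := by
    rw [← sq_eq_sq₀ (norm_nonneg _) zero_le_one, Complex.sq_norm, Complex.normSq_mk]
    linarith
  have h1 := integrable_reInner_pow (u := 1) (by simp) 4
  have hI := integrable_reInner_pow (u := Complex.I) (by simp) 4
  have h : ∫ z, (reInner z 1 ^ 4 + reInner z Complex.I ^ 4 + (reInner z ⟨a, a⟩ ^ 4 +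
      reInner z ⟨a, -a⟩ ^ 4)) ∂complexGaussian = 3 / 2 * ∫ z, ‖z‖ ^ 4 ∂complexGaussian := by
    rw [← integral_const_mul (3 / 2 : ℝ)]
    congr 1 with z
    rw [show ‖z‖ ^ 4 = (‖z‖ ^ 2) ^ 2 by ring, Complex.sq_norm, Complex.normSq_apply]
    have e : ∀ s : ℝ, (z.re * a + s * a) ^ 4 = (a ^ 2) ^ 2 * (z.re + s) ^ 4 := fun s => by ring
    simp only [reInner_eq, Complex.one_re, Complex.one_im, Complex.I_re, Complex.I_im]
    rw [e, show z.im * -a = -z.im * a by ring, e, ha2]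
    ring
  have hadd := integral_add (h1.add hI)
    ((integrable_reInner_pow hv 4).add (integrable_reInner_pow hw 4))
  simp only [Pi.add_apply] at hadd
  rw [hadd, integral_norm_pow_four_complexGaussian, integral_add h1 hI, integral_add (integrable_reInner_pow hv 4) (integrable_reInner_pow hw 4),
    integral_reInner_pow_eq (by simp), integral_reInner_pow_eq (by simp),
    integral_reInner_pow_eq hv, integral_reInner_pow_eq hw] at h
  rw [integral_reInner_pow_eq hu]
  linarith

end Gaussian

/-! ### Log-mean-exp of a finite centred family. -/

section Cumulants

/-- The arithmetic mean of `a` over the finite set `S`. -/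
noncomputable def mean {ι : Type*} (S : Finset ι) (a : ι → ℝ) : ℝ := ∑ i ∈ S, (S.card : ℝ)⁻¹ * a i

variable {ι : Type*} {S : Finset ι}

lemma mean_add (a b : ι → ℝ) : mean S (fun i => a i + b i) = mean S a + mean S b := by
  simp [mean, mul_add, Finset.sum_add_distrib]

lemma mean_sub (a b : ι → ℝ) : mean S (fun i => a i - b i) = mean S a - mean S b := by
  simp [mean, mul_sub, Finset.sum_sub_distrib]

lemma mean_const_mul (c : ℝ) (a : ι → ℝ) : mean S (fun i => c * a i) = c * mean S a := by
  simp only [mean, Finset.mul_sum]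
  exact Finset.sum_congr rfl fun i _ => by ring

lemma mean_const (hS : S.Nonempty) (c : ℝ) : mean S (fun _ => c) = c := by
  have : (S.card : ℝ) ≠ 0 := by exact_mod_cast hS.card_ne_zero
  simp [mean, this]

lemma mean_congr {a b : ι → ℝ} (h : ∀ i ∈ S, a i = b i) : mean S a = mean S b :=
  Finset.sum_congr rfl fun i hi => by rw [h i hi]

lemma mean_mono {a b : ι → ℝ} (h : ∀ i ∈ S, a i ≤ b i) : mean S a ≤ mean S b :=
  Finset.sum_le_sum fun i hi => mul_le_mul_of_nonneg_left (h i hi) (by positivity)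

lemma abs_mean_le (hS : S.Nonempty) {a : ι → ℝ} {r : ℝ} (h : ∀ i ∈ S, |a i| ≤ r) :
    |mean S a| ≤ r := by
  rw [abs_le]
  constructor
  · rw [← mean_const hS (-r)]
    exact mean_mono fun i hi => (abs_le.1 (h i hi)).1
  · rw [← mean_const hS r]
    exact mean_mono fun i hi => (abs_le.1 (h i hi)).2

lemma abs_mean_pow_le (hS : S.Nonempty) {a : ι → ℝ} {r : ℝ} (h : ∀ i ∈ S, |a i| ≤ r) (n : ℕ) :
    |mean S fun i => a i ^ n| ≤ r ^ n :=
  abs_mean_le hS fun i hi => by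
    rw [abs_pow]; exact pow_le_pow_left₀ (abs_nonneg _) (h i hi) n

lemma mean_exp_pos (hS : S.Nonempty) (a : ι → ℝ) : 0 < mean S fun i => Real.exp (a i) :=
  Finset.sum_pos (fun i _ => mul_pos (by
    have := hS.card_pos
    positivity) (Real.exp_pos _)) hS

lemma abs_log_mean_exp_le (hS : S.Nonempty) {a : ι → ℝ} {r : ℝ} (h : ∀ i ∈ S, |a i| ≤ r) :
    |Real.log (mean S fun i => Real.exp (a i))| ≤ r := by
  rw [abs_le]
  constructor
  · rw [Real.le_log_iff_exp_le (mean_exp_pos hS a), ← mean_const hS (Real.exp (-r))]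
    exact mean_mono fun i hi => Real.exp_le_exp.2 (abs_le.1 (h i hi)).1
  · rw [Real.log_le_iff_le_exp (mean_exp_pos hS a), ← mean_const hS (Real.exp r)]
    exact mean_mono fun i hi => Real.exp_le_exp.2 (abs_le.1 (h i hi)).2

lemma abs_log_one_add_sub_le {u : ℝ} (hu : |u| ≤ 1 / 2) :
    |Real.log (1 + u) - (u - u ^ 2 / 2)| ≤ 2 * |u| ^ 3 := by
  have h := Real.abs_log_sub_add_sum_range_le (x := -u) (by rw [abs_neg]; linarith) 2
  simp only [Finset.sum_range_succ, Finset.sum_range_zero, abs_neg, sub_neg_eq_add] at h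
  norm_num at h
  rw [show Real.log (1 + u) - (u - u ^ 2 / 2) = -u + u ^ 2 / 2 + Real.log (1 + u) by ring]
  refine h.trans ?_
  rw [div_le_iff₀ (by linarith)]
  have := pow_nonneg (abs_nonneg u) 3
  nlinarith

/-- The fourth-order cumulant expansion of the uniform distribution on a centred family. -/
lemma abs_log_mean_exp_sub_le (hS : S.Nonempty) {a : ι → ℝ} {r : ℝ}
    (h : ∀ i ∈ S, |a i| ≤ r) (h0 : mean S a = 0) :
    |Real.log (mean S fun i => Real.exp (a i)) -
      ((mean S fun i => a i ^ 2) / 2 + (mean S fun i => a i ^ 3) / 6 +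
        (mean S fun i => a i ^ 4) / 24 - (mean S fun i => a i ^ 2) ^ 2 / 8)| ≤ 24 * r ^ 5 := by
  have hr : 0 ≤ r := by
    obtain ⟨i, hi⟩ := hS
    exact (abs_nonneg _).trans (h i hi)
  have h2 := abs_le.1 (abs_mean_pow_le hS h 2)
  have h3 := abs_le.1 (abs_mean_pow_le hS h 3)
  have h4 := abs_le.1 (abs_mean_pow_le hS h 4)
  have hlog := abs_le.1 (abs_log_mean_exp_le hS h)
  have hu : (1 / 2 ≥ r) → |(mean S fun i => Real.exp (a i)) - 1 -
      ((mean S fun i => a i ^ 2) / 2 + (mean S fun i => a i ^ 3) / 6 +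
        (mean S fun i => a i ^ 4) / 24)| ≤ r ^ 5 / 100 := by
    intro hr2
    have e : (mean S fun i => Real.exp (a i)) - 1 -
        ((mean S fun i => a i ^ 2) / 2 + (mean S fun i => a i ^ 3) / 6 +
          (mean S fun i => a i ^ 4) / 24) =
        mean S fun i => Real.exp (a i) - ∑ m ∈ Finset.range 5, a i ^ m / m.factorial := by
      simp only [mean_sub, Finset.sum_range_succ, Finset.sum_range_zero, Nat.factorial, mean_add,
        div_eq_inv_mul, mean_const_mul, pow_zero, pow_one, mean_const hS, h0]
      norm_num
      ring
    rw [e]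
    refine abs_mean_le hS fun i hi => ?_
    refine (Real.exp_bound ((h i hi).trans (by linarith)) (by norm_num)).trans ?_
    norm_num [Nat.factorial]
    -- The Taylor remainder constant is `6 / (5! * 5) = 1 / 100`.
    have := pow_le_pow_left₀ (abs_nonneg _) (h i hi) 5
    linarith
  generalize (mean S fun i => a i ^ 2) = m₂ at *
  generalize (mean S fun i => a i ^ 3) = m₃ at *
  generalize (mean S fun i => a i ^ 4) = m₄ at *
  have hm₂ : m₂ ^ 2 ≤ r ^ 4 := by
    rw [show r ^ 4 = (r ^ 2) ^ 2 by ring]; exact sq_le_sq' h2.1 h2.2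
  have hm₂' := sq_nonneg m₂
  -- For small `r`, the Taylor expansions of `exp` and `log` are composed. For `r > 1/2` every term
  -- is separately at most a multiple of `r ^ 5`; this crude case is what requires a constant as
  -- large as `24`.
  rcases le_or_gt r (1 / 2) with hr2 | hr2
  · replace hu := abs_le.1 (hu hr2)
    obtain ⟨u, hu_eq⟩ : ∃ u, (mean S fun i => Real.exp (a i)) = 1 + u :=
      ⟨(mean S fun i => Real.exp (a i)) - 1, by ring⟩
    rw [hu_eq] at hu ⊢
    have r3 : r ^ 3 ≤ r ^ 2 / 2 := by nlinarith [sq_nonneg r]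
    have r4 : r ^ 4 ≤ r ^ 3 / 2 := by nlinarith [pow_nonneg hr 3]
    have r5 : r ^ 5 ≤ r ^ 4 / 2 := by nlinarith [pow_nonneg hr 4]
    have r6 : r ^ 6 ≤ r ^ 5 / 2 := by nlinarith [pow_nonneg hr 5]
    have r5' := pow_nonneg hr 5
    have hd : |u - m₂ / 2| ≤ r ^ 3 := by rw [abs_le]; constructor <;> linarith
    have hs : |u + m₂ / 2| ≤ 2 * r ^ 2 := by rw [abs_le]; constructor <;> linarith
    have hur : |u| ≤ r ^ 2 := by rw [abs_le]; constructor <;> linarith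
    have hu3 : |u| ^ 3 ≤ r ^ 6 := by
      rw [show r ^ 6 = (r ^ 2) ^ 3 by ring]; exact pow_le_pow_left₀ (abs_nonneg _) hur 3
    have hl := abs_le.1 (abs_log_one_add_sub_le (u := u) (by nlinarith))
    -- Factoring the difference of squares shows that replacing `u²` by `m₂²/4` costs only order `r
    -- ^ 5`.
    have hp : |(u - m₂ / 2) * (u + m₂ / 2)| ≤ r ^ 3 * (2 * r ^ 2) := by
      rw [abs_mul]; exact mul_le_mul hd hs (abs_nonneg _) (by positivity)
    have hp' := abs_le.1 hp
    have e : (u - m₂ / 2) * (u + m₂ / 2) = u ^ 2 - m₂ ^ 2 / 4 := by ring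
    have e' : r ^ 3 * (2 * r ^ 2) = 2 * r ^ 5 := by ring
    rw [e, e'] at hp'
    rw [abs_le]; constructor <;> linarith
  · have r5 : r ^ 4 ≤ 2 * r ^ 5 := by nlinarith [pow_nonneg hr 4]
    have r4 : r ^ 3 ≤ 2 * r ^ 4 := by nlinarith [pow_nonneg hr 3]
    have r3 : r ^ 2 ≤ 2 * r ^ 3 := by nlinarith [pow_nonneg hr 2]
    have r2 : r ≤ 2 * r ^ 2 := by nlinarith
    rw [abs_le]; constructor <;> linarith

end Cumulants

/-! ### Expansion in powers of the amplitude `s`. -/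

section LowSNR

/-- The cumulant expansion is applied with radius `2s(1+t)`, and terms beyond `s ^ 4` join the
error. The constant `1000` covers `24 * 2 ^ 5 = 768` plus the three truncation errors. The bound is
polynomial in `t`, hence Gaussian-integrable when `t = ‖z‖`. -/
lemma abs_log_mean_exp_scaled_sub_le {ι : Type*} {S : Finset ι} (hS : S.Nonempty) {q g : ι → ℝ}
    {s t : ℝ} (hs0 : 0 ≤ s) (hs1 : s ≤ 1) (hq : ∀ i ∈ S, |q i| ≤ 1) (hg : ∀ i ∈ S, |g i| ≤ t)
    (hq0 : mean S q = 0) (hg0 : mean S g = 0) :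
    |Real.log (mean S fun i => Real.exp (2 * s * (s * q i + g i))) -
      (2 * s ^ 2 * (mean S fun i => g i ^ 2) + 4 * s ^ 3 * (mean S fun i => q i * g i) +
        2 * s ^ 4 * (mean S fun i => q i ^ 2) + 4 / 3 * s ^ 3 * (mean S fun i => g i ^ 3) +
        4 * s ^ 4 * (mean S fun i => q i * g i ^ 2) + 2 / 3 * s ^ 4 * (mean S fun i => g i ^ 4) -
        2 * s ^ 4 * (mean S fun i => g i ^ 2) ^ 2)| ≤ 1000 * s ^ 5 * (1 + t) ^ 5 := by
  have ht : 0 ≤ t := by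
    obtain ⟨i, hi⟩ := hS
    exact (abs_nonneg _).trans (hg i hi)
  obtain ⟨l, hl⟩ : ∃ l, l = 1 + t := ⟨_, rfl⟩
  have hl1 : 1 ≤ l := by linarith
  have hl0 : 0 ≤ l := by linarith
  have hgl : ∀ i ∈ S, |g i| ≤ l := fun i hi => (hg i hi).trans (by linarith)
  have hsq : ∀ i ∈ S, |s * q i| ≤ s := fun i hi => by
    rw [abs_mul, abs_of_nonneg hs0]
    exact mul_le_of_le_one_right hs0 (hq i hi)
  have hb : ∀ i ∈ S, |s * q i + g i| ≤ l := fun i hi =>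
    (abs_add_le _ _).trans (by linarith [hsq i hi, hg i hi])
  have ha : ∀ i ∈ S, |2 * s * (s * q i + g i)| ≤ 2 * s * l := fun i hi => by
    rw [abs_mul, abs_of_nonneg (by positivity : 0 ≤ 2 * s)]
    exact mul_le_mul_of_nonneg_left (hb i hi) (by positivity)
  have h0 : (mean S fun i => 2 * s * (s * q i + g i)) = 0 := by
    rw [mean_const_mul, mean_add, mean_const_mul, hq0, hg0]; ring
  have hmain := abs_le.1 (abs_log_mean_exp_sub_le hS ha h0)
  simp only [mul_pow (2 * s), mean_const_mul] at hmain
  have h2 : (mean S fun i => (s * q i + g i) ^ 2) = s ^ 2 * (mean S fun i => q i ^ 2) +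
      2 * s * (mean S fun i => q i * g i) + mean S fun i => g i ^ 2 := by
    simp only [← mean_const_mul, ← mean_add]
    exact mean_congr fun i _ => by ring
  have h3 : |(mean S fun i => (s * q i + g i) ^ 3) - ((mean S fun i => g i ^ 3) +
      3 * s * mean S fun i => q i * g i ^ 2)| ≤ 4 * s ^ 2 * l ^ 5 := by
    simp only [← mean_const_mul, ← mean_add, ← mean_sub]
    refine abs_mean_le hS fun i hi => ?_
    have e : (s * q i + g i) ^ 3 - (g i ^ 3 + 3 * s * (q i * g i ^ 2)) =
        (s * q i) ^ 2 * (3 * g i + s * q i) := by ring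
    rw [e, abs_mul, abs_pow]
    have h4 : |3 * g i + s * q i| ≤ 4 * l := by
      refine (abs_add_le _ _).trans ?_
      rw [abs_mul, abs_of_pos (by norm_num : (0 : ℝ) < 3)]
      linarith [hsq i hi, hgl i hi]
    calc |s * q i| ^ 2 * |3 * g i + s * q i| ≤ s ^ 2 * (4 * l) :=
          mul_le_mul (pow_le_pow_left₀ (abs_nonneg _) (hsq i hi) 2) h4 (abs_nonneg _) (by positivity)
      _ = 4 * s ^ 2 * l := by ring
      _ ≤ 4 * s ^ 2 * l ^ 5 :=
          mul_le_mul_of_nonneg_left (le_self_pow₀ hl1 (by norm_num)) (by positivity)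
  have h4 : |(mean S fun i => (s * q i + g i) ^ 4) - mean S fun i => g i ^ 4| ≤ 4 * s * l ^ 5 := by
    rw [← mean_sub]
    refine abs_mean_le hS fun i hi => ?_
    have e : (s * q i + g i) ^ 4 - g i ^ 4 =
        s * q i * ((s * q i + g i + g i) * ((s * q i + g i) ^ 2 + g i ^ 2)) := by ring
    rw [e, abs_mul, abs_mul (s * q i + g i + g i)]
    have i1 : |s * q i + g i + g i| ≤ 2 * l :=
      (abs_add_le _ _).trans (by linarith [hb i hi, hgl i hi])
    have i2 : |(s * q i + g i) ^ 2 + g i ^ 2| ≤ 2 * l ^ 2 := by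
      refine (abs_add_le _ _).trans ?_
      rw [abs_pow, abs_pow]
      linarith [pow_le_pow_left₀ (abs_nonneg _) (hb i hi) 2,
        pow_le_pow_left₀ (abs_nonneg _) (hgl i hi) 2]
    calc _ ≤ s * ((2 * l) * (2 * l ^ 2)) :=
          mul_le_mul (hsq i hi) (mul_le_mul i1 i2 (abs_nonneg _) (by positivity))
            (by positivity) hs0
      _ = 4 * s * l ^ 3 := by ring
      _ ≤ 4 * s * l ^ 5 :=
          mul_le_mul_of_nonneg_left (pow_le_pow_right₀ hl1 (by norm_num)) (by positivity)
  have h5 : |(mean S fun i => (s * q i + g i) ^ 2) ^ 2 - (mean S fun i => g i ^ 2) ^ 2| ≤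
      4 * s * l ^ 5 := by
    have i1 : |(mean S fun i => (s * q i + g i) ^ 2) - mean S fun i => g i ^ 2| ≤ s * (2 * l) := by
      rw [← mean_sub]
      refine abs_mean_le hS fun i hi => ?_
      rw [show (s * q i + g i) ^ 2 - g i ^ 2 = s * q i * (s * q i + g i + g i) by ring, abs_mul]
      exact mul_le_mul (hsq i hi) ((abs_add_le _ _).trans (by linarith [hb i hi, hgl i hi]))
        (abs_nonneg _) hs0
    have i2 : |(mean S fun i => (s * q i + g i) ^ 2) + mean S fun i => g i ^ 2| ≤ 2 * l ^ 2 :=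
      (abs_add_le _ _).trans
        (by linarith [abs_mean_pow_le hS hb 2, abs_mean_pow_le hS hgl 2])
    rw [sq_sub_sq, mul_comm, abs_mul]
    calc _ ≤ s * (2 * l) * (2 * l ^ 2) := mul_le_mul i1 i2 (abs_nonneg _) (by positivity)
      _ = 4 * s * l ^ 3 := by ring
      _ ≤ 4 * s * l ^ 5 :=
          mul_le_mul_of_nonneg_left (pow_le_pow_right₀ hl1 (by norm_num)) (by positivity)
  rw [← hl]
  generalize (mean S fun i => (s * q i + g i) ^ 2) = b₂ at *
  generalize (mean S fun i => (s * q i + g i) ^ 3) = b₃ at *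
  generalize (mean S fun i => (s * q i + g i) ^ 4) = b₄ at *
  have hmul : ∀ {c x y : ℝ}, 0 ≤ c → |x| ≤ y → -(c * y) ≤ c * x ∧ c * x ≤ c * y := by
    intro c x y hc hxy
    rw [← abs_le, abs_mul, abs_of_nonneg hc]
    exact mul_le_mul_of_nonneg_left hxy hc
  have k3 := hmul (pow_nonneg hs0 3) h3
  have k4 := hmul (pow_nonneg hs0 4) h4
  have k5 := hmul (pow_nonneg hs0 4) h5
  have hpos : 0 ≤ s ^ 5 * l ^ 5 := by positivity
  have e2 : s ^ 2 * b₂ = s ^ 2 * (s ^ 2 * (mean S fun i => q i ^ 2) +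
      2 * s * (mean S fun i => q i * g i) + mean S fun i => g i ^ 2) := by rw [h2]
  clear h2 h3 h4 h5
  ring_nf at hmain k3 k4 k5 e2 hpos ⊢
  rw [abs_le]
  constructor <;> linarith

end LowSNR

/-! ### Capacity of centred constellations on the unit circle. -/

section UnitConstellation

lemma integrable_mean {ι : Type*} {S : Finset ι} {f : ℂ → ι → ℝ} {μ : Measure ℂ}
    (h : ∀ i ∈ S, Integrable (fun z => f z i) μ) : Integrable (fun z => mean S (f z)) μ :=
  integrable_finsetSum _ fun i hi => (h i hi).const_mul _

lemma integral_mean {ι : Type*} {S : Finset ι} {f : ℂ → ι → ℝ} {μ : Measure ℂ}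
    (h : ∀ i ∈ S, Integrable (fun z => f z i) μ) :
    ∫ z, mean S (f z) ∂μ = mean S fun i => ∫ z, f z i ∂μ := by
  unfold mean
  rw [integral_finsetSum _ fun i hi => (h i hi).const_mul _]
  simp only [integral_const_mul]

lemma mean_reInner_eq_zero {S : Finset ℂ} (h0 : ∑ x ∈ S, x = 0) (z : ℂ) :
    mean S (reInner z) = 0 := by
  have h : ∑ y ∈ S, reInner z y = 0 := by
    simp only [reInner]
    rw [← Complex.re_sum, ← Finset.mul_sum, ← map_sum, h0]
    simp
  rw [mean, ← Finset.mul_sum, h, mul_zero]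

lemma logLikelihoodSum_uniformProb {S : Finset ℂ} (h1 : ∀ x ∈ S, ‖x‖ = 1) {x : ℂ} (hx : x ∈ S)
    (snr : ℝ) (z : ℂ) :
    logLikelihoodSum S (uniformProb S) snr x z = -2 * √snr ^ 2 - 2 * √snr * reInner z x +
      Real.log (mean S fun y => Real.exp (2 * √snr * (√snr * reInner x y + reInner z y))) := by
  have hS : S.Nonempty := ⟨x, hx⟩
  have e : (∑ y ∈ S, uniformProb S y *
      Real.exp (-‖((√snr : ℝ) : ℂ) * (x - y) + z‖ ^ 2 + ‖z‖ ^ 2)) =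
      Real.exp (-2 * √snr ^ 2 - 2 * √snr * reInner z x) *
        mean S fun y => Real.exp (2 * √snr * (√snr * reInner x y + reInner z y)) := by
    rw [← mean_const_mul]
    refine mean_congr fun y hy => ?_
    rw [← Real.exp_add]
    congr 1
    have hx2 : ‖x‖ ^ 2 = 1 := by rw [h1 x hx, one_pow]
    have hy2 : ‖y‖ ^ 2 = 1 := by rw [h1 y hy, one_pow]
    rw [Complex.sq_norm, Complex.normSq_apply] at hx2 hy2 ⊢
    rw [Complex.sq_norm, Complex.normSq_apply]
    simp only [reInner_eq, Complex.add_re, Complex.add_im, Complex.re_ofReal_mul,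
      Complex.im_ofReal_mul, Complex.sub_re, Complex.sub_im]
    linear_combination (-√snr ^ 2) * hx2 - √snr ^ 2 * hy2
  rw [logLikelihoodSum, e, Real.log_mul (Real.exp_pos _).ne' (mean_exp_pos hS _).ne',
    Real.log_exp]

lemma continuous_log_mean_exp {S : Finset ℂ} (hS : S.Nonempty) (s : ℝ) (x : ℂ) :
    Continuous fun z => Real.log (mean S fun y =>
      Real.exp (2 * s * (s * reInner x y + reInner z y))) := by
  refine Continuous.log ?_ fun z => (mean_exp_pos hS _).ne'
  unfold mean reInner
  fun_prop

lemma integrable_log_mean_exp {S : Finset ℂ} (h1 : ∀ x ∈ S, ‖x‖ = 1) {x : ℂ} (hx : x ∈ S)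
    {s : ℝ} (hs : 0 ≤ s) :
    Integrable (fun z => Real.log (mean S fun y =>
      Real.exp (2 * s * (s * reInner x y + reInner z y)))) complexGaussian := by
  refine integrable_complexGaussian_of_le (continuous_log_mean_exp ⟨x, hx⟩ s x)
    (2 * s * (s + 1)) 1 fun z => ?_
  refine abs_log_mean_exp_le ⟨x, hx⟩ fun y hy => ?_
  have hq := abs_reInner_le (h1 y hy) x
  rw [h1 x hx] at hq
  have hg := abs_reInner_le (h1 y hy) z
  rw [abs_mul, abs_of_nonneg (by positivity : 0 ≤ 2 * s), pow_one, mul_assoc (2 * s)]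
  refine mul_le_mul_of_nonneg_left ((abs_add_le _ _).trans ?_) (by positivity)
  rw [abs_mul, abs_of_nonneg hs]
  nlinarith [norm_nonneg z, mul_nonneg hs (norm_nonneg z)]

lemma integrable_reInner {u : ℂ} (hu : ‖u‖ = 1) :
    Integrable (fun z => reInner z u) complexGaussian := by
  simpa using integrable_reInner_pow hu 1

lemma integrable_logLikelihoodSum {S : Finset ℂ} (h1 : ∀ x ∈ S, ‖x‖ = 1) {x : ℂ} (hx : x ∈ S)
    (snr : ℝ) : Integrable (logLikelihoodSum S (uniformProb S) snr x) complexGaussian := by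
  rw [funext (logLikelihoodSum_uniformProb h1 hx snr)]
  exact ((integrable_const _).sub ((integrable_reInner (h1 x hx)).const_mul _)).add
    (integrable_log_mean_exp h1 hx (Real.sqrt_nonneg _))

lemma integral_logLikelihoodSum {S : Finset ℂ} (h1 : ∀ x ∈ S, ‖x‖ = 1) {x : ℂ} (hx : x ∈ S)
    (snr : ℝ) : ∫ z, logLikelihoodSum S (uniformProb S) snr x z ∂complexGaussian =
      -2 * √snr ^ 2 + ∫ z, Real.log (mean S fun y =>
        Real.exp (2 * √snr * (√snr * reInner x y + reInner z y))) ∂complexGaussian := by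
  have hi : Integrable (fun z => -2 * √snr ^ 2 - 2 * √snr * reInner z x) complexGaussian :=
    (integrable_const _).sub ((integrable_reInner (h1 x hx)).const_mul _)
  simp only [logLikelihoodSum_uniformProb h1 hx snr]
  rw [integral_add hi (integrable_log_mean_exp h1 hx (Real.sqrt_nonneg _)),
    integral_sub (integrable_const _) ((integrable_reInner (h1 x hx)).const_mul _),
    integral_const_mul (2 * √snr), integral_reInner]
  simp

lemma integrable_mean_reInner_pow {S : Finset ℂ} (h1 : ∀ x ∈ S, ‖x‖ = 1) (n : ℕ) :
    Integrable (fun z => mean S fun y => reInner z y ^ n) complexGaussian :=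
  integrable_mean fun y hy => integrable_reInner_pow (h1 y hy) n

lemma integral_mean_reInner_pow {S : Finset ℂ} (hS : S.Nonempty) (h1 : ∀ x ∈ S, ‖x‖ = 1) {n : ℕ}
    {c : ℝ} (h : ∀ u : ℂ, ‖u‖ = 1 → ∫ z, reInner z u ^ n ∂complexGaussian = c) :
    ∫ z, (mean S fun y => reInner z y ^ n) ∂complexGaussian = c := by
  rw [integral_mean fun y hy => integrable_reInner_pow (h1 y hy) n,
    mean_congr fun y hy => h y (h1 y hy), mean_const hS]

lemma integrable_mean_sq_sq {S : Finset ℂ} (hS : S.Nonempty) (h1 : ∀ x ∈ S, ‖x‖ = 1) :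
    Integrable (fun z => (mean S fun y => reInner z y ^ 2) ^ 2) complexGaussian := by
  refine integrable_complexGaussian_of_le (by unfold mean reInner; fun_prop) 1 4 fun z => ?_
  rw [abs_pow, one_mul, show (1 + ‖z‖) ^ 4 = ((1 + ‖z‖) ^ 2) ^ 2 by ring]
  refine pow_le_pow_left₀ (abs_nonneg _) (abs_mean_pow_le hS (fun y hy => ?_) 2) 2
  linarith [abs_reInner_le (h1 y hy) z]

lemma abs_integral_log_mean_exp_sub_le {S : Finset ℂ} (h1 : ∀ x ∈ S, ‖x‖ = 1)
    (h0 : ∑ x ∈ S, x = 0) {x : ℂ} (hx : x ∈ S) {s : ℝ} (hs0 : 0 ≤ s) (hs1 : s ≤ 1) :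
    |(∫ z, Real.log (mean S fun y =>
        Real.exp (2 * s * (s * reInner x y + reInner z y))) ∂complexGaussian) -
      (s ^ 2 + s ^ 4 * (2 * (mean S fun y => reInner x y ^ 2) + 1 / 2 -
        2 * ∫ z, (mean S fun y => reInner z y ^ 2) ^ 2 ∂complexGaussian))| ≤
      1000 * s ^ 5 * ∫ z : ℂ, (1 + ‖z‖) ^ 5 ∂complexGaussian := by
  have hS : S.Nonempty := ⟨x, hx⟩
  have i2 := (integrable_mean_reInner_pow h1 2).const_mul (2 * s ^ 2)
  have iq1 : Integrable (fun z => mean S fun y => reInner x y * reInner z y) complexGaussian :=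
    integrable_mean fun y hy => (integrable_reInner (h1 y hy)).const_mul _
  have iq2 : Integrable (fun z => mean S fun y => reInner x y * reInner z y ^ 2) complexGaussian :=
    integrable_mean fun y hy => (integrable_reInner_pow (h1 y hy) 2).const_mul _
  have e1 : ∫ z, (mean S fun y => reInner x y * reInner z y) ∂complexGaussian = 0 := by
    rw [integral_mean fun y hy => (integrable_reInner (h1 y hy)).const_mul _]
    simp only [integral_const_mul, integral_reInner, mul_zero, mean_const hS]
  have e2 : ∫ z, (mean S fun y => reInner x y * reInner z y ^ 2) ∂complexGaussian = 0 := by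
    rw [integral_mean fun y hy => (integrable_reInner_pow (h1 y hy) 2).const_mul _]
    simp only [integral_const_mul]
    -- The second moment of the projection is `1/2` in every direction, so only the mean of `reInner
    -- x` is left, which is zero.
    rw [mean_congr (b := fun y => 1 / 2 * reInner x y) fun y hy => by
      rw [integral_reInner_sq (h1 y hy), mul_comm], mean_const_mul, mean_reInner_eq_zero h0,
      mul_zero]
  have iq1 := iq1.const_mul (4 * s ^ 3)
  have iq2 := iq2.const_mul (4 * s ^ 4)
  have ic : Integrable (fun _ : ℂ => 2 * s ^ 4 * mean S fun y => reInner x y ^ 2)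
    complexGaussian := integrable_const _
  have i3 := (integrable_mean_reInner_pow h1 3).const_mul (4 / 3 * s ^ 3)
  have i4 := (integrable_mean_reInner_pow h1 4).const_mul (2 / 3 * s ^ 4)
  have i5 := (integrable_mean_sq_sq hS h1).const_mul (2 * s ^ 4)
  have hadd : ∀ {f g : ℂ → ℝ}, Integrable f complexGaussian → Integrable g complexGaussian →
      Integrable (fun z => f z + g z) complexGaussian := fun hf hg => hf.add hg
  have hsub : ∀ {f g : ℂ → ℝ}, Integrable f complexGaussian → Integrable g complexGaussian →
      Integrable (fun z => f z - g z) complexGaussian := fun hf hg => hf.sub hg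
  have j1 := hadd i2 iq1
  have j2 := hadd j1 ic
  have j3 := hadd j2 i3
  have j4 := hadd j3 iq2
  have j5 := hadd j4 i4
  have j6 := hsub j5 i5
  have hT := integral_sub j5 i5
  rw [integral_add j4 i4, integral_add j3 iq2, integral_add j2 i3, integral_add j1 ic,
    integral_add i2 iq1] at hT
  simp only [integral_const_mul, integral_const, e1, e2, probReal_univ, one_smul] at hT
  rw [integral_mean_reInner_pow hS h1 fun u hu => integral_reInner_sq hu,
    integral_mean_reInner_pow hS h1 fun u _ => integral_reInner_pow_of_odd u (by decide),
    integral_mean_reInner_pow hS h1 fun u hu => integral_reInner_pow_four hu] at hT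
  have hT' := hT.trans (show _ = s ^ 2 + s ^ 4 * (2 * (mean S fun y => reInner x y ^ 2) + 1 / 2 -
        2 * ∫ z, (mean S fun y => reInner z y ^ 2) ^ 2 ∂complexGaussian) by ring)
  rw [← hT', ← integral_sub (integrable_log_mean_exp h1 hx hs0) j6, ← integral_const_mul]
  have ib : Integrable (fun z : ℂ => 1000 * s ^ 5 * (1 + ‖z‖) ^ 5) complexGaussian :=
    integrable_complexGaussian_of_le (by fun_prop) (1000 * s ^ 5) 5 fun z => by
      rw [abs_of_nonneg (by positivity)]
  rw [← Real.norm_eq_abs]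
  refine norm_integral_le_of_norm_le ib (ae_of_all _ fun z => ?_)
  exact abs_log_mean_exp_scaled_sub_le hS hs0 hs1
    (fun y hy => (abs_reInner_le (h1 y hy) x).trans_eq (h1 x hx))
    (fun y hy => abs_reInner_le (h1 y hy) z) (mean_reInner_eq_zero h0 x) (mean_reInner_eq_zero h0 z)

lemma abs_uniformCapacity_sub_le {S : Finset ℂ} (hS : S.Nonempty) (h1 : ∀ x ∈ S, ‖x‖ = 1)
    (h0 : ∑ x ∈ S, x = 0) {A : ℝ} (hA : ∀ x ∈ S, (mean S fun y => reInner x y ^ 2) = A)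
    {snr : ℝ} (hs0 : 0 ≤ snr) (hs1 : snr ≤ 1) :
    |uniformCapacity S snr - (snr + -(2 * A + 1 / 2 -
        2 * ∫ z, (mean S fun y => reInner z y ^ 2) ^ 2 ∂complexGaussian) * snr ^ 2)| ≤
      1000 * (∫ z : ℂ, (1 + ‖z‖) ^ 5 ∂complexGaussian) * √snr ^ 5 := by
  have hsq := Real.sq_sqrt hs0
  set K := ∫ z, (mean S fun y => reInner z y ^ 2) ^ 2 ∂complexGaussian with hK
  have e : uniformCapacity S snr - (snr + -(2 * A + 1 / 2 - 2 * K) * snr ^ 2) =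
      mean S fun x => -((∫ z, Real.log (mean S fun y =>
        Real.exp (2 * √snr * (√snr * reInner x y + reInner z y))) ∂complexGaussian) -
      (√snr ^ 2 + √snr ^ 4 * (2 * (mean S fun y => reInner x y ^ 2) + 1 / 2 - 2 * K))) := by
    have h : uniformCapacity S snr =
        mean S fun x => -∫ z, logLikelihoodSum S (uniformProb S) snr x z ∂complexGaussian := by
      simp only [uniformCapacity, constrainedCapacity, mean, uniformProb, mul_neg,
        Finset.sum_neg_distrib]
    rw [h, ← mean_const hS (snr + -(2 * A + 1 / 2 - 2 * K) * snr ^ 2), ← mean_sub]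
    refine mean_congr fun x hx => ?_
    rw [integral_logLikelihoodSum h1 hx, hA x hx, show √snr ^ 4 = (√snr ^ 2) ^ 2 by ring, hsq]
    ring
  rw [e]
  refine abs_mean_le hS fun x hx => ?_
  rw [abs_neg]
  refine (abs_integral_log_mean_exp_sub_le h1 h0 hx (Real.sqrt_nonneg _)
    (Real.sqrt_le_one.2 hs1)).trans_eq (by ring)

end UnitConstellation

/-! ### From a quantitative bound to the expansion, and its uniqueness. -/

section Expansion

lemma HasLowSNRExpansion.of_abs_sub_le {C : ℝ → ℝ} {c₁ c₂ K : ℝ}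
    (h : ∀ snr : ℝ, 0 ≤ snr → snr ≤ 1 → |C snr - (c₁ * snr + c₂ * snr ^ 2)| ≤ K * √snr ^ 5) :
    HasLowSNRExpansion C c₁ c₂ := by
  have hO : (fun snr : ℝ => C snr - (c₁ * snr + c₂ * snr ^ 2)) =O[𝓝[>] 0]
      fun snr => √snr * snr ^ 2 := by
    refine IsBigO.of_bound K ?_
    filter_upwards [Ioc_mem_nhdsGT (zero_lt_one' ℝ)] with t ht
    refine (h t ht.1.le ht.2).trans_eq ?_
    rw [Real.norm_of_nonneg (by positivity), show √t ^ 5 = √t * (√t ^ 2) ^ 2 by ring,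
      Real.sq_sqrt ht.1.le]
  refine hO.trans_isLittleO ?_
  have h0 : (fun snr : ℝ => √snr) =o[𝓝[>] 0] fun _ => (1 : ℝ) := by
    rw [isLittleO_one_iff]
    exact (Real.continuous_sqrt.tendsto' 0 0 Real.sqrt_zero).mono_left nhdsWithin_le_nhds
  simpa using h0.mul_isBigO (isBigO_refl (fun snr : ℝ => snr ^ 2) _)

lemma HasLowSNRExpansion.unique {C : ℝ → ℝ} {a₁ a₂ b₁ b₂ : ℝ} (ha : HasLowSNRExpansion C a₁ a₂)
    (hb : HasLowSNRExpansion C b₁ b₂) : a₂ = b₂ := by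
  have h : (fun t : ℝ => (b₁ - a₁) * t + (b₂ - a₂) * t ^ 2) =o[𝓝[>] 0] fun t => t ^ 2 :=
    (ha.sub hb).congr_left fun t => by ring
  have hlim : Tendsto (fun t : ℝ => ((b₁ - a₁) * t + (b₂ - a₂) * t ^ 2) / t ^ 2) (𝓝[>] 0) (𝓝 0) :=
    h.tendsto_div_nhds_zero
  have ht : Tendsto (fun t : ℝ => t) (𝓝[>] 0) (𝓝 0) := nhdsWithin_le_nhds
  -- Multiplying the quotient, which tends to `0`, by `t` isolates the linear coefficient; once that
  -- is zero, the quotient itself is the constant `b₂ - a₂`.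
  have h1 : b₁ - a₁ = 0 := by
    have l1 : Tendsto (fun t : ℝ => (b₁ - a₁) + (b₂ - a₂) * t) (𝓝[>] 0) (𝓝 (b₁ - a₁)) := by
      simpa using (ht.const_mul (b₂ - a₂)).const_add (b₁ - a₁)
    have l2 : Tendsto (fun t : ℝ => (b₁ - a₁) + (b₂ - a₂) * t) (𝓝[>] 0) (𝓝 0) := by
      have := hlim.mul ht
      rw [zero_mul] at this
      refine this.congr' ?_
      filter_upwards [self_mem_nhdsWithin] with t ht
      have : t ≠ 0 := (Set.mem_Ioi.1 ht).ne'
      field_simp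
    exact tendsto_nhds_unique l1 l2
  have l3 : Tendsto (fun _ : ℝ => b₂ - a₂) (𝓝[>] 0) (𝓝 0) := by
    refine hlim.congr' ?_
    filter_upwards [self_mem_nhdsWithin] with t ht
    have : t ≠ 0 := (Set.mem_Ioi.1 ht).ne'
    rw [h1]
    field_simp
    ring
  linarith [tendsto_nhds_unique tendsto_const_nhds l3]

lemma HasLowSNRExpansion.isSecondOrderCoefficient_iff {C : ℝ → ℝ} {c₁ c₂ : ℝ}
    (h : HasLowSNRExpansion C c₁ c₂) (c : ℝ) : IsSecondOrderCoefficient C c ↔ c = c₂ :=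
  ⟨fun ⟨_, hc⟩ => hc.unique h, fun hc => ⟨c₁, hc ▸ h⟩⟩

end Expansion

/-! ### Power sums of PSK and the two values of the coefficient. -/

section PSK

/-- The standard primitive `M`-th root of unity. -/
noncomputable def pskRoot (M : ℕ) : ℂ := Complex.exp (2 * Real.pi * Complex.I / M)

lemma psk_eq_image (M : ℕ) (θ : ℝ) :
    psk M θ = (Finset.range M).image fun k => Complex.exp (θ * Complex.I) * pskRoot M ^ k := by
  unfold psk pskRoot
  congr 1 with k
  rw [← Complex.exp_nat_mul, ← Complex.exp_add]
  congr 1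
  push_cast
  ring

lemma psk_injOn {M : ℕ} (hM : M ≠ 0) (θ : ℝ) :
    Set.InjOn (fun k => Complex.exp (θ * Complex.I) * pskRoot M ^ k) (Finset.range M : Set ℕ) := by
  intro i hi j hj hij
  have hi' : i < M := by simpa using hi
  have hj' : j < M := by simpa using hj
  exact (Complex.isPrimitiveRoot_exp M hM).pow_inj hi' hj'
    (mul_left_cancel₀ (Complex.exp_ne_zero _) hij)

lemma card_psk {M : ℕ} (hM : M ≠ 0) (θ : ℝ) : (psk M θ).card = M := by
  rw [psk_eq_image, Finset.card_image_of_injOn (psk_injOn hM θ), Finset.card_range]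

lemma psk_nonempty {M : ℕ} (hM : M ≠ 0) (θ : ℝ) : (psk M θ).Nonempty := by
  rw [← Finset.card_pos, card_psk hM]
  omega

lemma norm_of_mem_psk {M : ℕ} {θ : ℝ} {x : ℂ} (hx : x ∈ psk M θ) : ‖x‖ = 1 := by
  simp only [psk, Finset.mem_image] at hx
  obtain ⟨k, -, rfl⟩ := hx
  exact Complex.norm_exp_ofReal_mul_I _

/-- A geometric sum with ratio `ω ^ n ≠ 1`, where `ω` is the primitive root. The case `n = 1` gives
centring; `n = 2` is available exactly when `M > 2`. -/
lemma sum_psk_pow {M n : ℕ} (hn : n ≠ 0) (hM : n < M) (θ : ℝ) : ∑ x ∈ psk M θ, x ^ n = 0 := by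
  have hM0 : M ≠ 0 := by omega
  have hr : IsPrimitiveRoot (pskRoot M) M := Complex.isPrimitiveRoot_exp M hM0
  rw [psk_eq_image, Finset.sum_image (psk_injOn hM0 θ)]
  simp only [mul_pow, ← pow_mul, mul_comm _ n]
  simp only [pow_mul _ n, ← Finset.mul_sum]
  rw [geom_sum_eq (hr.pow_ne_one_of_pos_of_lt hn hM), ← pow_mul, mul_comm n, pow_mul, hr.pow_eq_one]
  simp

/-- For unit `y`, `Re(z ȳ)² = ‖z‖²/2 + Re(z² ȳ²)/2`, and the second part averages to zero. -/
lemma mean_psk_reInner_sq {M : ℕ} (hM : 2 < M) (θ : ℝ) (z : ℂ) :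
    (mean (psk M θ) fun y => reInner z y ^ 2) = ‖z‖ ^ 2 / 2 := by
  have h0 : mean (psk M θ) (fun y => (z ^ 2 * starRingEnd ℂ (y ^ 2)).re) = 0 := by
    rw [mean, ← Finset.mul_sum, ← Complex.re_sum, ← Finset.mul_sum, ← map_sum,
      sum_psk_pow two_ne_zero hM]
    simp
  have hS := psk_nonempty (M := M) (by omega) θ
  rw [mean_congr (b := fun y => ‖z‖ ^ 2 / 2 + 1 / 2 * (z ^ 2 * starRingEnd ℂ (y ^ 2)).re),
    mean_add, mean_const hS, mean_const_mul, h0, mul_zero, add_zero]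
  intro y hy
  have hy2 : ‖y‖ ^ 2 = 1 := by rw [norm_of_mem_psk hy, one_pow]
  rw [Complex.sq_norm, Complex.normSq_apply] at hy2 ⊢
  simp only [reInner_eq, pow_two, map_mul, Complex.mul_re, Complex.mul_im, Complex.conj_re,
    Complex.conj_im]
  linear_combination ((z.re * z.re + z.im * z.im) / 2) * hy2

/-- The two points are opposite, so the squared projections coincide. -/
lemma mean_psk_two_reInner_sq (θ : ℝ) {x : ℂ} (hx : x ∈ psk 2 θ) (z : ℂ) :
    (mean (psk 2 θ) fun y => reInner z y ^ 2) = reInner z x ^ 2 := by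
  have hr : pskRoot 2 = -1 := by
    rw [pskRoot, ← Complex.exp_pi_mul_I]
    congr 1
    push_cast
    ring
  have h : ∀ y ∈ psk 2 θ, y = Complex.exp (θ * Complex.I) ∨ y = -Complex.exp (θ * Complex.I) := by
    intro y hy
    simpa [psk_eq_image, Finset.range_add_one, hr, or_comm, eq_comm] using hy
  have hsq : ∀ y ∈ psk 2 θ, reInner z y ^ 2 = reInner z (Complex.exp (θ * Complex.I)) ^ 2 := by
    intro y hy
    rcases h y hy with rfl | rfl
    · rfl
    · simp only [reInner_eq, Complex.neg_re, Complex.neg_im]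
      ring
  rw [mean_congr hsq, mean_const ⟨x, hx⟩, hsq x hx]

lemma hasLowSNRExpansion_uniformCapacity {S : Finset ℂ} (hS : S.Nonempty) (h1 : ∀ x ∈ S, ‖x‖ = 1)
    (h0 : ∑ x ∈ S, x = 0) {A : ℝ} (hA : ∀ x ∈ S, (mean S fun y => reInner x y ^ 2) = A) :
    HasLowSNRExpansion (uniformCapacity S) 1 (-(2 * A + 1 / 2 -
        2 * ∫ z, (mean S fun y => reInner z y ^ 2) ^ 2 ∂complexGaussian)) :=
  .of_abs_sub_le fun snr hs0 hs1 => by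
    rw [one_mul]
    exact abs_uniformCapacity_sub_le hS h1 h0 hA hs0 hs1

lemma hasLowSNRExpansion_psk_two (θ : ℝ) :
    HasLowSNRExpansion (uniformCapacity (psk 2 θ)) 1 (-1) := by
  have hS := psk_nonempty two_ne_zero θ
  obtain ⟨x, hx⟩ := id hS
  have h := hasLowSNRExpansion_uniformCapacity hS (fun y hy => norm_of_mem_psk hy)
    (by simpa using sum_psk_pow one_ne_zero one_lt_two θ) (A := 1) fun y hy => by
      rw [mean_psk_two_reInner_sq θ hy, reInner, Complex.mul_conj', norm_of_mem_psk hy]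
      simp
  simp only [mean_psk_two_reInner_sq θ hx, ← pow_mul] at h
  norm_num [integral_reInner_pow_four (norm_of_mem_psk hx)] at h
  exact h

lemma hasLowSNRExpansion_psk {M : ℕ} (hM : 2 < M) (θ : ℝ) :
    HasLowSNRExpansion (uniformCapacity (psk M θ)) 1 (-(1 / 2)) := by
  have h := hasLowSNRExpansion_uniformCapacity (psk_nonempty (M := M) (by omega) θ)
    (fun y hy => norm_of_mem_psk hy)
    (by simpa using sum_psk_pow one_ne_zero (by omega) θ) (A := 1 / 2) fun y hy => by
      rw [mean_psk_reInner_sq hM, norm_of_mem_psk hy, one_pow]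
  simp only [mean_psk_reInner_sq hM, div_pow, ← pow_mul, integral_div] at h
  norm_num [integral_norm_pow_four_complexGaussian] at h ⊢
  exact h

end PSK

/-- For every phase offset `θ`: the expectation defining the uniform capacity of `M`-PSK is over
integrable functions, and its second-order coefficient exists, is unique, and equals `-1` if
`M = 2` and `-1/2` if `M > 2`. -/
theorem corollary1 (M : ℕ) (θ : ℝ) :
    (2 ≤ M → ∀ snr : ℝ, 0 ≤ snr → ∀ x ∈ psk M θ,
      Integrable (logLikelihoodSum (psk M θ) (uniformProb (psk M θ)) snr x) complexGaussian) ∧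
    (M = 2 → ∀ c₂ : ℝ, IsSecondOrderCoefficient (uniformCapacity (psk M θ)) c₂ ↔ c₂ = -1) ∧
    (2 < M → ∀ c₂ : ℝ, IsSecondOrderCoefficient (uniformCapacity (psk M θ)) c₂ ↔ c₂ = -(1 / 2)) := by
  refine ⟨fun _ snr _ x hx => integrable_logLikelihoodSum (fun y hy => norm_of_mem_psk hy) hx snr, ?_,
    fun hM => (hasLowSNRExpansion_psk hM θ).isSecondOrderCoefficient_iff⟩
  rintro rfl
  exact (hasLowSNRExpansion_psk_two θ).isSecondOrderCoefficient_iff
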